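/- For positive integers $l,m,n$ and integers $a_{j,k},b_{i,k},c_{i,j}$ ($1\le i\le l$, $1\le j\le m$, $1\le k\le n$) let $$S=\Big\{x\in\mathbb{Z}_{\ge 0}^{l\times m\times n}\ :\ \sum_i x_{i,j,k}=a_{j,k},\ \sum_j x_{i,j,k}=b_{i,k},\ \sum_k x_{i,j,k}=c_{i,j}\Big\}$$ be the set of $l\times m\times n$ tables with these line sums. For a $\{0,1\}$-valued $d\times(l\times m\times n)$ matrix $W$ let $\mathrm{conv}(WS)=\mathrm{conv}\{Wx : x\in S\}\subset\mathbb{R}^d$, and let $t(d;l,m)$ be the largest number of vertices of $\mathrm{conv}(WS)$ over all $n$, all such $S$ and all such $W$. The Graver basis $\mathcal{G}(B)$ of an integer matrix $B$ is the set of $\sqsubseteq$-minimal elements of $\{x \text{ integer} : Bx=0,\ x\ne 0\}$, where $x\sqsubseteq y$ means $x_iy_i\ge 0$ and $|x_i|\le|y_i|$ for all $i$. Let $A_1=I_{lm}$, let $A_2$ be the $(l+m)\times lm$ vertex-edge incidence matrix of the complete bipartite graph $K_{l,m}$, and let $$A^{(n)}=\begin{pmatrix}A_1&A_1&\cdots&A_1\\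 A_2&0&\cdots&0\\ 0&A_2&\cdots&0\\ \vdots&\vdots&\ddots&\vdots\\ 0&0&\cdots&A_2\end{pmatrix}$$ be the $n$-fold product of the bimatrix with blocks $A_1,A_2$. The Graver complexity $g(l,m)$ is the largest number of nonzero bricks $x^i\in\mathbb{Z}^{lm}$ of any element $x=(x^1,\dots,x^n)$ of $\mathcal{G}(A^{(n)})$, for any $n$. **Proposition.** Let $d\ge 1$. For all $l,m\ge 2$ the maxima $g(l,m)$ and $t(d;l,m)$ exist and are finite, and $$t(d;l,m)\ \le\ 2\sum_{k=0}^{d-1}\binom{\tfrac12\left((2g(l,m)\min\{l,m\}+1)^d-3\right)}{k}\ =\ O\left((2g(l,m)\min\{l,m\})^{d(d-1)}\right),$$ where the constant in the $O$ depends only on $d$ (and not on $l,m$). -/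

import Mathlib

open scoped Matrix

namespace CoarseProj

/-- The partial order `x ⊑ y` on integer vectors: `x` and `y` lie in the same orthant and
`|x i| ≤ |y i|` for every coordinate `i`. -/
def Conformal {T : Type*} (x y : T → ℤ) : Prop :=
  ∀ i, 0 ≤ x i * y i ∧ |x i| ≤ |y i|

/-- The Graver basis of an integer matrix: the `⊑`-minimal elements among the nonzero integer
vectors in the kernel. -/
def graverBasis {R T : Type*} [Fintype T] (A : Matrix R T ℤ) : Set (T → ℤ) :=
  {x | A *ᵥ x = 0 ∧ x ≠ 0 ∧ ∀ y : T → ℤ, A *ᵥ y = 0 → y ≠ 0 → Conformal y x → y = x}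

/-- The `n`-fold product of the bimatrix with blocks `A₁` and `A₂`: one block row
`(A₁ A₁ ⋯ A₁)` on top of the block diagonal matrix with `n` diagonal blocks `A₂`.
The column `(i, t)` is the `t`-th coordinate of the `i`-th brick. -/
def nFold {R S T : Type*} (n : ℕ) (A₁ : Matrix R T ℤ) (A₂ : Matrix S T ℤ) :
    Matrix (R ⊕ (Fin n × S)) (Fin n × T) ℤ :=
  Matrix.of fun row col =>
    match row with
    | Sum.inl r => A₁ r col.2
    | Sum.inr p => if p.1 = col.1 then A₂ p.2 col.2 else 0

/-- The numbers of nonzero bricks `x^i` of the elements `x` of the Graver bases of the `n`-fold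
products of a bimatrix, for all `n`. -/
def brickCounts {R S T : Type*} [Fintype T] (A₁ : Matrix R T ℤ) (A₂ : Matrix S T ℤ) : Set ℕ :=
  {c | ∃ n : ℕ, ∃ x ∈ graverBasis (nFold n A₁ A₂), c = {i : Fin n | ∃ t, x (i, t) ≠ 0}.ncard}

/-- The Graver complexity of a bimatrix: the largest number of nonzero bricks in any element of
the Graver basis of any of its `n`-fold products. -/
noncomputable def graverComplexity {R S T : Type*} [Fintype T]
    (A₁ : Matrix R T ℤ) (A₂ : Matrix S T ℤ) : ℕ :=
  sSup (brickCounts A₁ A₂)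

/-- The `(l + m) × lm` vertex-edge incidence matrix of the complete bipartite graph `K_{l,m}`;
the column `(i, j)` is the edge joining the `i`-th left vertex to the `j`-th right vertex. -/
noncomputable def bipartiteIncidence (l m : ℕ) :
    Matrix (Fin l ⊕ Fin m) (Fin l × Fin m) ℤ := by
  classical
  exact ((completeBipartiteGraph (Fin l) (Fin m)).incMatrix ℤ).submatrix id
    (fun e => s(Sum.inl e.1, Sum.inr e.2))

/-- The numbers of nonzero bricks in the Graver bases of the `n`-fold products, for all `n`, of the
`(lm, l + m) × lm` bimatrix whose blocks are the identity `I_{lm}` and the incidence matrix of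
`K_{l,m}`. -/
def tableBrickCounts (l m : ℕ) : Set ℕ :=
  brickCounts (1 : Matrix (Fin l × Fin m) (Fin l × Fin m) ℤ) (bipartiteIncidence l m)

/-- `g(l, m)`: the Graver complexity of the bimatrix with blocks `I_{lm}` and the incidence matrix
of `K_{l,m}`. -/
noncomputable def g (l m : ℕ) : ℕ :=
  graverComplexity (1 : Matrix (Fin l × Fin m) (Fin l × Fin m) ℤ) (bipartiteIncidence l m)

/-- The set of nonnegative integer `l × m × n` tables with prescribed line sums. -/
def tables {l m n : ℕ} (a : Fin m → Fin n → ℤ) (b : Fin l → Fin n → ℤ) (c : Fin l → Fin m → ℤ) :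
    Set (Fin l × Fin m × Fin n → ℤ) :=
  {x | (∀ p, 0 ≤ x p) ∧
    (∀ j k, ∑ i, x (i, j, k) = a j k) ∧
    (∀ i k, ∑ j, x (i, j, k) = b i k) ∧
    (∀ i j, ∑ k, x (i, j, k) = c i j)}

/-- The projection polytope `conv(WS) = conv {Wx : x ∈ S}` in `ℝ^d`. -/
def projection {d : ℕ} {T : Type*} [Fintype T] (W : Matrix (Fin d) T ℤ) (S : Set (T → ℤ)) :
    Set (Fin d → ℝ) :=
  convexHull ℝ ((fun x : T → ℤ => fun i : Fin d => (((W *ᵥ x) i : ℤ) : ℝ)) '' S)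

/-- The numbers of vertices (extreme points) of `conv(WS)`, over all `n`, all sets `S` of
`l × m × n` tables with integer line sums, and all binary `d × (l × m × n)` matrices `W`. -/
def vertexCounts (d l m : ℕ) : Set ℕ∞ :=
  {v | ∃ (n : ℕ) (a : Fin m → Fin n → ℤ) (b : Fin l → Fin n → ℤ) (c : Fin l → Fin m → ℤ)
      (W : Matrix (Fin d) (Fin l × Fin m × Fin n) ℤ),
      (∀ i p, W i p = 0 ∨ W i p = 1) ∧
      v = ((projection W (tables a b c)).extremePoints ℝ).encard}

/-- `t(d; l, m)`: the largest number of vertices of `conv(WS)`. -/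
noncomputable def t (d l m : ℕ) : ℕ∞ :=
  sSup (vertexCounts d l m)

/-- The number `2 ∑_{k < d} C(((2 g(l,m) min{l,m} + 1)^d - 3) / 2, k)`. For `d ≥ 1` and
`l, m ≥ 2` the base of the power is odd and greater than `3`, so that the subtraction and the
division by `2` are exact. -/
noncomputable def vertexBound (d l m : ℕ) : ℕ :=
  2 * ∑ k ∈ Finset.range d, (((2 * g l m * min l m + 1) ^ d - 3) / 2).choose k

end CoarseProj

namespace CoarseProj

/-! Two tables `x`, `x'` with equal line sums differ by a kernel vector of the `n`-fold matrix,
hence by a conformal sum of Graver elements; adding any single one of them to `x` gives a table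
again. Let `K = g l m * min l m`. If every Graver element has its image under `W` in the box `[-K,
K]^d`, then a functional maximal at a vertex is nonpositive on the images of all moves leaving it.
Two distinct vertices therefore need generic functionals with different signs on the box
(`encard_extremePoints_projection_le`), so vertices inject into the regions of a central arrangement
with one hyperplane per pair of opposite nonzero box vectors. Sauer–Shelah bounds the number of
regions (`card_le_of_patterns`).

For the box, each brick of a Graver element is split conformally into unions of alternating cycles
of `K_{l,m}`, on which a 0/1 functional is at most `min l m` in absolute value
(`exists_shortKernel_conformal`). Spreading the pieces over separate bricks keeps the vector in a
Graver basis (`split_mem_graverBasis`), so there are at most `g l m` pieces. Finiteness of `g` is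
Dickson's lemma for the multiplicities of the pieces (`exists_bound_of_bricks_mem`). -/

/-! ### Conformal order and conformal sums -/

theorem abs_add_abs_sub_eq_iff (a b : ℤ) : |a| + |b - a| = |b| ↔ 0 ≤ a * b ∧ |a| ≤ |b| := by
  constructor
  · intro h
    have h1 : |a| ≤ |b| := by have := abs_nonneg (b - a); omega
    refine ⟨?_, h1⟩
    rcases le_total 0 a with ha | ha <;> rcases le_total 0 b with hb | hb
    · positivity
    · have : a = 0 ∨ b = 0 := by
        rw [abs_of_nonneg ha, abs_of_nonpos hb, abs_of_nonpos (by omega)] at h; omega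
      rcases this with rfl | rfl <;> simp
    · have : a = 0 ∨ b = 0 := by
        rw [abs_of_nonpos ha, abs_of_nonneg hb, abs_of_nonneg (by omega)] at h; omega
      rcases this with rfl | rfl <;> simp
    · exact mul_nonneg_of_nonpos_of_nonpos ha hb
  · rintro ⟨h, h1⟩
    rcases le_total 0 a with ha | ha <;> rcases le_total 0 b with hb | hb
    · rw [abs_of_nonneg ha, abs_of_nonneg hb] at *
      rw [abs_of_nonneg (by omega)]; omega
    · rcases mul_eq_zero.1 (le_antisymm (mul_nonpos_of_nonneg_of_nonpos ha hb) h) with rfl | rfl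
      · simp
      · simp_all
    · rcases mul_eq_zero.1 (le_antisymm (mul_nonpos_of_nonpos_of_nonneg ha hb) h) with rfl | rfl
      · simp
      · simp_all
    · rw [abs_of_nonpos ha, abs_of_nonpos hb] at *
      rw [abs_of_nonpos (by omega)]; omega

/-- Equality in the triangle inequality is an additive form of conformality: it reduces later checks
to linear arithmetic and makes the ℓ¹ norm a descent measure. -/
theorem conformal_iff {T : Type*} {x y : T → ℤ} :
    Conformal x y ↔ ∀ i, |x i| + |y i - x i| = |y i| :=
  forall_congr' fun i => (abs_add_abs_sub_eq_iff (x i) (y i)).symm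

theorem conformal_of_sum_abs {T J : Type*} [Fintype J] {v : J → T → ℤ} {z : T → ℤ}
    (hsum : ∑ j, v j = z) (habs : ∀ t, ∑ j, |v j t| = |z t|) (j : J) : Conformal (v j) z := by
  classical
  rw [conformal_iff]
  intro t
  apply le_antisymm
  · have h1 : z t - v j t = ∑ i ∈ Finset.univ.erase j, v i t := by
      rw [← hsum, Finset.sum_apply, ← Finset.add_sum_erase _ _ (Finset.mem_univ j)]; ring
    rw [h1, ← habs, ← Finset.add_sum_erase _ _ (Finset.mem_univ j)]
    gcongr
    exact Finset.abs_sum_le_sum_abs _ _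
  · have := abs_add_le (v j t) (z t - v j t)
    simpa using this

theorem sum_abs_pos {T : Type*} [Fintype T] {x : T → ℤ} (hx : x ≠ 0) : 0 < ∑ i, |x i| := by
  obtain ⟨i, hi⟩ := Function.ne_iff.1 hx
  exact Finset.sum_pos' (fun _ _ => abs_nonneg _) ⟨i, Finset.mem_univ _, abs_pos.2 hi⟩

theorem Conformal.sum_abs {T : Type*} [Fintype T] {x y : T → ℤ} (h : Conformal x y) :
    ∑ i, |x i| + ∑ i, |(y - x) i| = ∑ i, |y i| := by
  rw [← Finset.sum_add_distrib]
  exact Finset.sum_congr rfl fun i _ => conformal_iff.1 h i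

theorem Conformal.trans {T : Type*} {x y z : T → ℤ} (h : Conformal x y) (h' : Conformal y z) :
    Conformal x z := by
  rw [conformal_iff] at *
  intro i
  have h1 := h i
  have h2 := h' i
  have h3 := abs_add_le (z i - y i) (y i - x i)
  have h4 := abs_add_le (x i) (z i - x i)
  rw [sub_add_sub_cancel] at h3
  rw [add_sub_cancel] at h4
  omega

theorem Conformal.refl {T : Type*} (x : T → ℤ) : Conformal x x := by
  simp [conformal_iff]

/-- Below every nonzero vector of the kernel there is an element of the Graver basis. -/
theorem exists_mem_graverBasis_conformal {R T : Type*} [Fintype T] (A : Matrix R T ℤ)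
    (z : T → ℤ) (hz : A *ᵥ z = 0) (hz0 : z ≠ 0) : ∃ h ∈ graverBasis A, Conformal h z := by
  induction hn : (∑ i, |z i|).toNat using Nat.strong_induction_on generalizing z with
  | _ n ih =>
    by_cases hG : z ∈ graverBasis A
    · exact ⟨z, hG, Conformal.refl z⟩
    · simp only [graverBasis, Set.mem_ofPred_eq, not_and, not_forall] at hG
      obtain ⟨y, hy, hy0, hyz, hne⟩ := hG hz hz0
      have h1 := hyz.sum_abs
      have h2 := sum_abs_pos (sub_ne_zero.2 (Ne.symm hne))
      have h3 := sum_abs_pos hy0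
      obtain ⟨h, hh, hc⟩ := ih _ (by omega) y hy hy0 rfl
      exact ⟨h, hh, hc.trans hyz⟩

/-- If every nonzero vector of a subgroup dominates a nonzero vector of `D`, then every vector of
the subgroup is a conformal sum of nonzero vectors of `D`. -/
theorem exists_conformal_sum {T : Type*} [Fintype T] (K : AddSubgroup (T → ℤ)) (D : Set (T → ℤ))
    (hDK : D ⊆ K) (hD : ∀ z ∈ K, z ≠ 0 → ∃ y ∈ D, y ≠ 0 ∧ Conformal y z) (z : T → ℤ)
    (hz : z ∈ K) : ∃ (N : ℕ) (v : Fin N → T → ℤ), (∀ j, v j ∈ D ∧ v j ≠ 0) ∧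
      ∑ j, v j = z ∧ ∀ t, ∑ j, |v j t| = |z t| := by
  induction hn : (∑ i, |z i|).toNat using Nat.strong_induction_on generalizing z with
  | _ n ih =>
    by_cases hz0 : z = 0
    · exact ⟨0, Fin.elim0, fun j => j.elim0, by simp [hz0], by simp [hz0]⟩
    -- Peeling off `y` lowers the ℓ¹ norm by that of `y`, and absolute values add up coordinatewise.
    · obtain ⟨y, hy, hy0, hyz⟩ := hD z hz hz0
      have h1 := hyz.sum_abs
      have h2 := sum_abs_pos hy0
      have h3 : 0 ≤ ∑ i, |(z - y) i| := Finset.sum_nonneg fun _ _ => abs_nonneg _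
      obtain ⟨N, v, hv, hsum, habs⟩ := ih _ (by omega) (z - y) (K.sub_mem hz (hDK hy)) rfl
      refine ⟨N + 1, Fin.cons y v, ?_, ?_, ?_⟩
      · intro j
        refine Fin.cases ?_ (fun j => ?_) j
        · exact ⟨hy, hy0⟩
        · simpa using hv j
      · simp [Fin.sum_univ_succ, hsum]
      · intro t
        simpa [Fin.sum_univ_succ, habs] using conformal_iff.1 hyz t

/-! ### Bricks of `n`-fold products and finiteness of the Graver complexity -/

theorem nFold_mulVec_eq_zero_iff {R S T : Type*} [Fintype T] {n : ℕ} {A₁ : Matrix R T ℤ}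
    {A₂ : Matrix S T ℤ} {x : Fin n × T → ℤ} :
    nFold n A₁ A₂ *ᵥ x = 0 ↔
      A₁ *ᵥ (fun t => ∑ i, x (i, t)) = 0 ∧ ∀ i, A₂ *ᵥ (fun t => x (i, t)) = 0 := by
  constructor
  · intro h
    refine ⟨funext fun r => ?_, fun i => funext fun s => ?_⟩
    · have := congrFun h (Sum.inl r)
      simp only [nFold, Matrix.mulVec, dotProduct, Matrix.of_apply, Fintype.sum_prod_type] at this
      rw [Finset.sum_comm] at this
      simpa [Matrix.mulVec, dotProduct, Finset.mul_sum] using this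
    · have := congrFun h (Sum.inr (i, s))
      simpa [nFold, Matrix.mulVec, dotProduct, Fintype.sum_prod_type, ite_mul] using this
  · rintro ⟨h1, h2⟩
    funext row
    rcases row with r | ⟨i, s⟩
    · have := congrFun h1 r
      simp only [nFold, Matrix.mulVec, dotProduct, Matrix.of_apply, Fintype.sum_prod_type]
      rw [Finset.sum_comm]
      simpa [Matrix.mulVec, dotProduct, Finset.mul_sum] using this
    · have := congrFun (h2 i) s
      simpa [nFold, Matrix.mulVec, dotProduct, Fintype.sum_prod_type, ite_mul] using this

/-- The vectors all of whose bricks lie in the kernel of `A₂`. -/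
def brickKer {S T : Type*} [Fintype T] (n : ℕ) (A₂ : Matrix S T ℤ) :
    AddSubgroup (Fin n × T → ℤ) where
  carrier := {x | ∀ i, A₂ *ᵥ (fun t => x (i, t)) = 0}
  zero_mem' := fun i => by
    exact Matrix.mulVec_zero A₂
  add_mem' := fun {x y} hx hy i => by
    have := Matrix.mulVec_add A₂ (fun t => x (i, t)) (fun t => y (i, t))
    rw [hx i, hy i, add_zero] at this
    exact this
  neg_mem' := fun {x} hx i => by
    have := Matrix.mulVec_neg (fun t => x (i, t)) A₂
    rw [hx i, neg_zero] at this
    exact this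

/-- `D` is a set of kernel vectors of `A₂` such that every nonzero kernel vector dominates a nonzero
element of `D`. -/
def Dominating {S T : Type*} [Fintype T] (A₂ : Matrix S T ℤ) (D : Set (T → ℤ)) : Prop :=
  (∀ y ∈ D, A₂ *ᵥ y = 0) ∧ ∀ u, A₂ *ᵥ u = 0 → u ≠ 0 → ∃ y ∈ D, y ≠ 0 ∧ Conformal y u

/-- Every vector whose bricks lie in the kernel of `A₂` is a conformal sum of vectors with a single
nonzero brick, taken from a dominating set. -/
theorem exists_brick_decomposition {S T : Type*} [Fintype T] {A₂ : Matrix S T ℤ}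
    {D : Set (T → ℤ)} (hD : Dominating A₂ D) {n : ℕ} {x : Fin n × T → ℤ}
    (hx : ∀ i, A₂ *ᵥ (fun t => x (i, t)) = 0) :
    ∃ (N : ℕ) (k : Fin N → Fin n) (y : Fin N → T → ℤ), (∀ j, y j ∈ D ∧ y j ≠ 0) ∧
      (∀ i t, x (i, t) = ∑ j, if i = k j then y j t else 0) ∧
      ∀ i t, |x (i, t)| = ∑ j, if i = k j then |y j t| else 0 := by
  let E : Set (Fin n × T → ℤ) := {x | ∃ k, ∃ y ∈ D, x = fun p => if p.1 = k then y p.2 else 0}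
  have hE : E ⊆ brickKer n A₂ := by
    rintro _ ⟨k, y, hy, rfl⟩ i
    by_cases h : i = k
    · simpa [h] using hD.1 y hy
    · simp only [h, if_false]
      exact Matrix.mulVec_zero A₂
  have hE' : ∀ z ∈ brickKer n A₂, z ≠ 0 → ∃ y ∈ E, y ≠ 0 ∧ Conformal y z := by
    intro z hz hz0
    obtain ⟨⟨i, t⟩, hit⟩ := Function.ne_iff.1 hz0
    obtain ⟨y, hy, hy0, hc⟩ := hD.2 _ (hz i) (Function.ne_iff.2 ⟨t, hit⟩)
    refine ⟨_, ⟨i, y, hy, rfl⟩, ?_, ?_⟩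
    · obtain ⟨s, hs⟩ := Function.ne_iff.1 hy0
      exact Function.ne_iff.2 ⟨(i, s), by simpa using hs⟩
    · rw [conformal_iff] at hc ⊢
      rintro ⟨i', s⟩
      by_cases h : i' = i
      · subst h
        simpa using hc s
      · simp [h]
  obtain ⟨N, v, hv, hsum, habs⟩ := exists_conformal_sum (brickKer n A₂) E hE hE' x hx
  choose k y hy hvy using fun j => (hv j).1
  refine ⟨N, k, y, fun j => ⟨hy j, ?_⟩, ?_, ?_⟩
  · rintro h0
    apply (hv j).2
    rw [hvy j, h0]
    funext p
    simp
  · intro i t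
    rw [← hsum, Finset.sum_apply]
    exact Finset.sum_congr rfl fun j _ => by rw [hvy j]
  · intro i t
    rw [← habs]
    refine Finset.sum_congr rfl fun j _ => ?_
    rw [hvy j]
    dsimp only
    split_ifs <;> simp

/-- Splitting the bricks of a Graver basis element into conformal summands gives a Graver basis
element again. -/
theorem split_mem_graverBasis {R S T : Type*} [Fintype T] {A₁ : Matrix R T ℤ}
    {A₂ : Matrix S T ℤ} {n N : ℕ} {x : Fin n × T → ℤ} (hx : x ∈ graverBasis (nFold n A₁ A₂))
    {k : Fin N → Fin n} {y : Fin N → T → ℤ} (hy : ∀ j, A₂ *ᵥ y j = 0)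
    (hsum : ∀ i t, x (i, t) = ∑ j, if i = k j then y j t else 0)
    (habs : ∀ i t, |x (i, t)| = ∑ j, if i = k j then |y j t| else 0) :
    (fun p : Fin N × T => y p.1 p.2) ∈ graverBasis (nFold N A₁ A₂) := by
  obtain ⟨hker, hx0, hmin⟩ := hx
  rw [nFold_mulVec_eq_zero_iff] at hker
  -- Merging bricks along `k` preserves their total, hence the condition imposed by `A₁`.
  have htotal : ∀ (z : Fin N × T → ℤ) (t : T),
      ∑ i, ∑ j, (if i = k j then z (j, t) else 0) = ∑ j, z (j, t) := by
    intro z t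
    rw [Finset.sum_comm]
    simp
  refine ⟨?_, ?_, ?_⟩
  · rw [nFold_mulVec_eq_zero_iff]
    refine ⟨?_, hy⟩
    have := hker.1
    simp only [hsum] at this
    rwa [funext fun t => htotal (fun p => y p.1 p.2) t] at this
  · rintro h0
    apply hx0
    funext ⟨i, t⟩
    rw [hsum]
    refine Finset.sum_eq_zero fun j _ => ?_
    have : y j t = 0 := congrFun h0 (j, t)
    simp [this]
  · intro z hz hz0 hc
    rw [nFold_mulVec_eq_zero_iff] at hz
    rw [conformal_iff] at hc
    -- `z'` merges `z` back into `n` bricks. The estimates `e1`–`e4` squeeze `|x|` between itself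
    -- and itself, so all are equalities and `z'` is conformal to `x`; minimality of `x` then forces
    -- `z' = x`, which leaves no room for `y - z`.
    set z' : Fin n × T → ℤ := fun p => ∑ j, if p.1 = k j then z (j, p.2) else 0 with hz'
    have e1 : ∀ i t, |z' (i, t)| ≤ ∑ j, if i = k j then |z (j, t)| else 0 := by
      intro i t
      refine (Finset.abs_sum_le_sum_abs _ _).trans (Finset.sum_le_sum fun j _ => ?_)
      dsimp only
      split_ifs <;> simp
    have e2 : ∀ i t, |x (i, t) - z' (i, t)| ≤
        ∑ j, if i = k j then |y j t - z (j, t)| else 0 := by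
      intro i t
      rw [hsum, hz', ← Finset.sum_sub_distrib]
      refine (Finset.abs_sum_le_sum_abs _ _).trans (Finset.sum_le_sum fun j _ => ?_)
      dsimp only
      split_ifs <;> simp
    have e3 : ∀ i t, (∑ j, if i = k j then |z (j, t)| else 0) +
        (∑ j, if i = k j then |y j t - z (j, t)| else 0) = |x (i, t)| := by
      intro i t
      rw [habs, ← Finset.sum_add_distrib]
      refine Finset.sum_congr rfl fun j _ => ?_
      have := hc (j, t)
      split_ifs
      · exact this
      · simp
    have e4 : ∀ i t, |x (i, t)| ≤ |z' (i, t)| + |x (i, t) - z' (i, t)| := fun i t => by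
      simpa using abs_add_le (z' (i, t)) (x (i, t) - z' (i, t))
    have hz'x : z' = x := by
      refine hmin z' ?_ ?_ ?_
      · rw [nFold_mulVec_eq_zero_iff]
        refine ⟨?_, fun i => ?_⟩
        · rw [funext fun t => htotal z t]
          exact hz.1
        · have : (fun t => z' (i, t)) =
              ∑ j, if i = k j then (fun t => z (j, t)) else 0 := by
            funext t
            rw [Finset.sum_apply]
            refine Finset.sum_congr rfl fun j _ => ?_
            dsimp only
            split_ifs <;> rfl
          rw [this, Matrix.mulVec_sum]
          refine Finset.sum_eq_zero fun j _ => ?_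
          split_ifs
          · exact hz.2 j
          · exact Matrix.mulVec_zero A₂
      · rintro h0
        apply hz0
        funext ⟨j, t⟩
        have h1 := e1 (k j) t
        have h2 := e2 (k j) t
        have h3 := e3 (k j) t
        have h4 := e4 (k j) t
        have h5 : ∑ j', (if k j = k j' then |z (j', t)| else 0) = 0 := by
          rw [h0] at *
          simp only [Pi.zero_apply, abs_zero] at *
          omega
        rw [Finset.sum_eq_zero_iff_of_nonneg (fun _ _ => by split_ifs <;> positivity)] at h5
        simpa using h5 j (Finset.mem_univ _)
      · rw [conformal_iff]
        rintro ⟨i, t⟩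
        have := e1 i t
        have := e2 i t
        have := e3 i t
        have := e4 i t
        omega
    funext ⟨j, t⟩
    have h1 := e1 (k j) t
    have h3 := e3 (k j) t
    rw [hz'x] at h1
    have h5 : ∑ j', (if k j = k j' then |y j' t - z (j', t)| else 0) = 0 := by
      refine le_antisymm (by omega) (Finset.sum_nonneg fun _ _ => by split_ifs <;> positivity)
    rw [Finset.sum_eq_zero_iff_of_nonneg (fun _ _ => by split_ifs <;> positivity)] at h5
    have h6 := h5 j (Finset.mem_univ _)
    simp only [if_true, abs_eq_zero, sub_eq_zero] at h6
    exact h6.symm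

/-- A Graver basis element all of whose bricks are nonzero elements of a finite set `D` of kernel
vectors of `A₂` has a bounded number of bricks. -/
theorem exists_bound_of_bricks_mem {R S T : Type*} [Fintype T] (A₁ : Matrix R T ℤ)
    (A₂ : Matrix S T ℤ) {D : Set (T → ℤ)} (hfin : D.Finite) :
    ∃ B : ℕ, ∀ (N : ℕ) (y : Fin N → T → ℤ), (∀ j, y j ∈ D ∧ y j ≠ 0) →
      (fun p : Fin N × T => y p.1 p.2) ∈ graverBasis (nFold N A₁ A₂) → N ≤ B := by
  classical
  have := hfin.fintype
  -- Whether the bricks satisfy the `A₁` condition depends only on how often each element of `D`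
  -- occurs. Minimal multiplicity vectors form an antichain in `ℕ^D`, which is finite by Dickson's
  -- lemma.
  let P : (D → ℕ) → Prop := fun c => c ≠ 0 ∧ A₁ *ᵥ (∑ y, c y • (y : T → ℤ)) = 0
  have hP : {c | Minimal P c}.Finite :=
    WellQuasiOrderedLE.finite_of_isAntichain (setOfPred_minimal_antichain P)
  obtain ⟨B, hB⟩ := (hP.image fun c => ∑ y, c y).bddAbove
  refine ⟨B, fun N y hy hG => ?_⟩
  obtain ⟨hker, hx0, hmin⟩ := hG
  rw [nFold_mulVec_eq_zero_iff] at hker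
  let f : Fin N → D := fun j => ⟨y j, (hy j).1⟩
  let c : D → ℕ := fun u => (Finset.univ.filter fun j => f j = u).card
  have hcN : ∑ u, c u = N := by
    rw [Finset.sum_card_fiberwise_eq_card_filter]; simp
  rw [← hcN]
  refine hB ⟨c, ⟨⟨?_, ?_⟩, ?_⟩, rfl⟩
  · obtain ⟨⟨j, t⟩, hj⟩ := Function.ne_iff.1 hx0
    intro h0
    have := congrFun h0 (f j)
    simp only [c, Pi.zero_apply, Finset.card_eq_zero] at this
    have hjm : j ∈ Finset.univ.filter fun j' => f j' = f j :=
      Finset.mem_filter.2 ⟨Finset.mem_univ j, rfl⟩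
    rw [this] at hjm
    simp at hjm
  · have h : (∑ u, c u • (u : T → ℤ)) = fun t => ∑ j, y j t := by
      have : ∑ j, y j = ∑ u, c u • (u : T → ℤ) := by
        rw [← Finset.sum_fiberwise Finset.univ f y]
        refine Finset.sum_congr rfl fun u _ => ?_
        rw [← Finset.sum_const]
        refine Finset.sum_congr rfl fun j hj => ?_
        rw [← (Finset.mem_filter.1 hj).2]
      rw [← this]
      funext t
      simp
    rw [h]
    exact hker.1
  · rintro b ⟨hb0, hb⟩ hbc
    -- A smaller multiplicity vector `b` selects `b u` of the bricks equal to `u`; zeroing the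
    -- others gives a nonzero conformal kernel vector, so by minimality no brick was dropped.
    choose J hJ hJcard using fun u => Finset.exists_subset_card_eq (hbc u)
    have hmem : ∀ u, ∀ j ∈ J u, f j = u := fun u j hj => (Finset.mem_filter.1 (hJ u hj)).2
    let z : Fin N × T → ℤ := fun p => if p.1 ∈ J (f p.1) then y p.1 p.2 else 0
    have hz : z = fun p : Fin N × T => y p.1 p.2 := by
      refine hmin z ?_ ?_ ?_
      · rw [nFold_mulVec_eq_zero_iff]
        constructor
        · have : (fun t => ∑ j, z (j, t)) = ∑ u, b u • (u : T → ℤ) := by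
            have h1 : ∑ j, (if j ∈ J (f j) then y j else 0) = ∑ u, b u • (u : T → ℤ) := by
              rw [← Finset.sum_fiberwise Finset.univ f]
              refine Finset.sum_congr rfl fun u _ => ?_
              rw [← hJcard u, ← Finset.sum_const]
              symm
              refine Finset.sum_subset_zero_on_sdiff (hJ u) ?_ ?_
              · intro j hj
                rw [Finset.mem_sdiff, Finset.mem_filter] at hj
                rw [hj.1.2, if_neg hj.2]
              · intro j hj
                rw [hmem u j hj, if_pos hj, ← hmem u j hj]
            rw [← h1]
            funext t
            rw [Finset.sum_apply]
            refine Finset.sum_congr rfl fun j _ => ?_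
            dsimp only [z]
            split_ifs <;> rfl
          rw [this]
          exact hb
        · intro j
          by_cases h : j ∈ J (f j)
          · simpa only [z, h, if_true] using hker.2 j
          · simp only [z, h, if_false]
            exact Matrix.mulVec_zero A₂
      · obtain ⟨u, hu⟩ := Function.ne_iff.1 hb0
        have : (J u).Nonempty := by
          rw [← Finset.card_pos, hJcard]
          exact Nat.pos_of_ne_zero hu
        obtain ⟨j, hj⟩ := this
        obtain ⟨t, ht⟩ := Function.ne_iff.1 (hy j).2
        refine Function.ne_iff.2 ⟨(j, t), ?_⟩
        simp only [z, hmem u j hj, hj, if_true]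
        exact ht
      · rw [conformal_iff]
        rintro ⟨j, t⟩
        dsimp only [z]
        split_ifs <;> simp
    intro u
    rw [← hJcard u]
    refine Finset.card_le_card fun j hj => ?_
    have hju := (Finset.mem_filter.1 hj).2
    by_contra hn
    obtain ⟨t, ht⟩ := Function.ne_iff.1 (hy j).2
    have := congrFun hz (j, t)
    simp only [z, hju, hn, if_false] at this
    exact ht this.symm

theorem split_length_mem_brickCounts {R S T : Type*} [Fintype T] {A₁ : Matrix R T ℤ}
    {A₂ : Matrix S T ℤ} {N : ℕ} {y : Fin N → T → ℤ} (hy : ∀ j, y j ≠ 0)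
    (hG : (fun p : Fin N × T => y p.1 p.2) ∈ graverBasis (nFold N A₁ A₂)) :
    N ∈ brickCounts A₁ A₂ := by
  refine ⟨N, _, hG, ?_⟩
  have : {i : Fin N | ∃ t, y i t ≠ 0} = Set.univ :=
    Set.eq_univ_of_forall fun j => Function.ne_iff.1 (hy j)
  rw [this, Set.ncard_univ]
  simp

/-- Splitting cannot lower the count: every nonzero brick of `x` receives at least one piece. -/
theorem bddAbove_brickCounts {R S T : Type*} [Fintype T] (A₁ : Matrix R T ℤ)
    {A₂ : Matrix S T ℤ} {D : Set (T → ℤ)} (hfin : D.Finite) (hD : Dominating A₂ D) :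
    BddAbove (brickCounts A₁ A₂) := by
  obtain ⟨B, hB⟩ := exists_bound_of_bricks_mem A₁ A₂ hfin
  refine ⟨B, ?_⟩
  rintro _ ⟨n, x, hx, rfl⟩
  obtain ⟨N, k, y, hy, hsum, habs⟩ :=
    exists_brick_decomposition hD (nFold_mulVec_eq_zero_iff.1 hx.1).2
  have hN := hB N y hy (split_mem_graverBasis hx (fun j => hD.1 _ (hy j).1) hsum habs)
  refine le_trans ?_ hN
  have hsub : {i : Fin n | ∃ t, x (i, t) ≠ 0} ⊆ Set.range k := by
    rintro i ⟨t, ht⟩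
    rw [hsum] at ht
    obtain ⟨j, -, hj⟩ := Finset.exists_ne_zero_of_sum_ne_zero ht
    exact ⟨j, by by_contra h; exact hj (if_neg fun h' => h h'.symm)⟩
  refine (Set.ncard_le_ncard hsub (Set.toFinite _)).trans ?_
  rw [← Set.image_univ]
  refine (Set.ncard_image_le Set.finite_univ).trans ?_
  simp [Set.ncard_univ]

/-- A linear functional which is bounded by `K` on the bricks of a dominating set is bounded by
`K` times the Graver complexity on the Graver bases. -/
theorem abs_dotProduct_le_of_mem_graverBasis {R S T : Type*} [Fintype T] {A₁ : Matrix R T ℤ}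
    {A₂ : Matrix S T ℤ} {D : Set (T → ℤ)} (hfin : D.Finite) (hD : Dominating A₂ D) {n : ℕ}
    {x : Fin n × T → ℤ} (hx : x ∈ graverBasis (nFold n A₁ A₂)) (w : Fin n × T → ℤ) {K : ℕ}
    (hw : ∀ i, ∀ y ∈ D, |∑ t, w (i, t) * y t| ≤ K) :
    |∑ p, w p * x p| ≤ (graverComplexity A₁ A₂ * K : ℕ) := by
  obtain ⟨N, k, y, hy, hsum, habs⟩ :=
    exists_brick_decomposition hD (nFold_mulVec_eq_zero_iff.1 hx.1).2
  have hN : N ≤ graverComplexity A₁ A₂ :=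
    le_csSup (bddAbove_brickCounts A₁ hfin hD) (split_length_mem_brickCounts (fun j => (hy j).2)
      (split_mem_graverBasis hx (fun j => hD.1 _ (hy j).1) hsum habs))
  have h1 : ∑ p, w p * x p = ∑ j, ∑ t, w (k j, t) * y j t := by
    rw [Fintype.sum_prod_type]
    simp only [hsum, Finset.mul_sum]
    calc ∑ i, ∑ t, ∑ j, w (i, t) * (if i = k j then y j t else 0)
        = ∑ i, ∑ j, ∑ t, w (i, t) * (if i = k j then y j t else 0) :=
          Finset.sum_congr rfl fun i _ => Finset.sum_comm
      _ = ∑ j, ∑ i, ∑ t, w (i, t) * (if i = k j then y j t else 0) := Finset.sum_comm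
      _ = ∑ j, ∑ t, w (k j, t) * y j t := by
          refine Finset.sum_congr rfl fun j _ => ?_
          rw [Finset.sum_eq_single (k j)]
          · simp
          · intro i _ hi
            simp [hi]
          · simp
  rw [h1]
  calc |∑ j, ∑ t, w (k j, t) * y j t| ≤ ∑ j, |∑ t, w (k j, t) * y j t| :=
        Finset.abs_sum_le_sum_abs _ _
    _ ≤ ∑ _j : Fin N, (K : ℤ) := Finset.sum_le_sum fun j _ => hw _ _ (hy j).1
    _ = (N * K : ℕ) := by simp
    _ ≤ (graverComplexity A₁ A₂ * K : ℕ) := by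
        exact_mod_cast Nat.mul_le_mul_right K hN

/-! ### Alternating cycles in the kernel of the incidence matrix -/

theorem bipartiteIncidence_inl {l m : ℕ} (i i' : Fin l) (j : Fin m) :
    bipartiteIncidence l m (Sum.inl i) (i', j) = if i = i' then 1 else 0 := by
  classical
  simp only [bipartiteIncidence, Matrix.submatrix_apply, id, SimpleGraph.incMatrix_apply,
    Set.indicator_apply]
  simp [SimpleGraph.incidenceSet]

theorem bipartiteIncidence_inr {l m : ℕ} (j j' : Fin m) (i : Fin l) :
    bipartiteIncidence l m (Sum.inr j) (i, j') = if j = j' then 1 else 0 := by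
  classical
  simp only [bipartiteIncidence, Matrix.submatrix_apply, id, SimpleGraph.incMatrix_apply,
    Set.indicator_apply]
  simp [SimpleGraph.incidenceSet]

theorem bipartiteIncidence_mulVec_eq_zero_iff {l m : ℕ} {u : Fin l × Fin m → ℤ} :
    bipartiteIncidence l m *ᵥ u = 0 ↔ (∀ i, ∑ j, u (i, j) = 0) ∧ ∀ j, ∑ i, u (i, j) = 0 := by
  rw [funext_iff, Sum.forall]
  refine and_congr (forall_congr' fun i => ?_) (forall_congr' fun j => ?_)
  · simp [Matrix.mulVec, dotProduct, Fintype.sum_prod_type, bipartiteIncidence_inl]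
  · simp [Matrix.mulVec, dotProduct, Fintype.sum_prod_type, bipartiteIncidence_inr]

/-- A self-map of a nonempty finite type has a periodic point. -/
theorem periodicPts_nonempty {V : Type*} [Finite V] [Nonempty V] (f : V → V) :
    (Function.periodicPts f).Nonempty := by
  obtain ⟨x⟩ := ‹Nonempty V›
  obtain ⟨a, b, hab, h⟩ := Set.finite_univ.exists_lt_map_eq_of_forall_mem
    (f := fun n : ℕ => f^[n] x) (fun _ => Set.mem_univ _)
  refine ⟨f^[a] x, Function.mk_mem_periodicPts (Nat.sub_pos_of_lt hab) ?_⟩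
  change f^[b - a] (f^[a] x) = f^[a] x
  rw [← Function.iterate_add_apply, Nat.sub_add_cancel hab.le]
  exact h.symm

/-- The kernel vectors of the incidence matrix of `K_{l,m}` on which all `0/1` functionals are
bounded by `min l m`. -/
def shortKernel (l m : ℕ) : Set (Fin l × Fin m → ℤ) :=
  {y | bipartiteIncidence l m *ᵥ y = 0 ∧ ∀ w : Fin l × Fin m → ℤ,
    (∀ p, w p = 0 ∨ w p = 1) → |∑ p, w p * y p| ≤ (min l m : ℕ)}

theorem finite_shortKernel (l m : ℕ) : (shortKernel l m).Finite := by
  classical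
  refine Set.Finite.subset (Set.Finite.pi' (t := fun _ : Fin l × Fin m =>
    Set.Icc (-(min l m : ℕ) : ℤ) (min l m : ℕ)) fun _ => Set.finite_Icc _ _) ?_
  intro y hy p
  have := hy.2 (fun q => if q = p then 1 else 0) (fun q => by split_ifs <;> simp)
  simp only [ite_mul, one_mul, zero_mul, Finset.sum_ite_eq', Finset.mem_univ, if_true] at this
  exact abs_le.1 this

/-- Every nonzero integer matrix with zero line sums dominates an alternating cycle of
`K_{l,m}`. -/
theorem exists_shortKernel_conformal {l m : ℕ} {u : Fin l × Fin m → ℤ}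
    (hr : ∀ i, ∑ j, u (i, j) = 0) (hc : ∀ j, ∑ i, u (i, j) = 0) (hu : u ≠ 0) :
    ∃ y ∈ shortKernel l m, y ≠ 0 ∧ Conformal y u := by
  classical
  -- An alternating walk: from a row go to a column where its entry is positive, then to a row where
  -- that column is negative. A row with a nonzero entry also has a positive one, so the walk stays
  -- in `V`.
  let V := {i : Fin l // ∃ j, 0 < u (i, j)}
  have hV : ∀ i j, u (i, j) ≠ 0 → ∃ j, 0 < u (i, j) := by
    intro i j hij
    obtain ⟨j, -, hj⟩ := Finset.exists_pos_of_sum_zero_of_exists_nonzero _ (hr i)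
      ⟨j, Finset.mem_univ j, hij⟩
    exact ⟨j, hj⟩
  have hneV : Nonempty V := by
    obtain ⟨⟨i, j⟩, hij⟩ := Function.ne_iff.1 hu
    exact ⟨⟨i, hV i j hij⟩⟩
  choose col hcol using fun v : V => v.2
  -- For columns never entered the value is arbitrary; the implication makes `row` total.
  have hrow : ∀ j, ∃ i : V, (∃ v : V, 0 < u (v, j)) → u (i, j) < 0 := by
    intro j
    by_cases hj : ∃ v : V, 0 < u (v, j)
    · obtain ⟨v, hv⟩ := hj
      by_contra! hcon
      have h1 : ∀ i, 0 ≤ u (i, j) := by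
        intro i
        by_cases h0 : u (i, j) = 0
        · exact h0.ge
        · exact (hcon ⟨i, hV i _ h0⟩).2
      have := (Finset.sum_eq_zero_iff_of_nonneg fun i _ => h1 i).1 (hc j) v (Finset.mem_univ _)
      exact hv.ne' this
    · exact ⟨hneV.some, fun h => absurd h hj⟩
  choose row hrow using hrow
  let q : V → V := fun v => row (col v)
  have hq : ∀ v : V, u (q v, col v) < 0 := fun v => hrow _ ⟨v, hcol v⟩
  have hbij := Function.bijOn_periodicPts q
  -- `q` permutes its periodic points, so `C` traces disjoint alternating cycles. Their columns are
  -- distinct too, because `q` factors through `col`.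
  let C : Finset V := Finset.univ.filter fun v => v ∈ Function.periodicPts q
  have hC : ∀ v, v ∈ C ↔ v ∈ Function.periodicPts q := fun v => by simp [C]
  have hqC : ∀ v ∈ C, q v ∈ C := fun v hv => (hC _).2 (hbij.mapsTo ((hC v).1 hv))
  have hqinj : ∀ v ∈ C, ∀ w ∈ C, q v = q w → v = w :=
    fun v hv w hw h => hbij.injOn ((hC v).1 hv) ((hC w).1 hw) h
  have hqsurj : ∀ v ∈ C, ∃ w, ∃ _ : w ∈ C, q w = v := fun v hv => by
    obtain ⟨w, hw, h⟩ := hbij.surjOn ((hC v).1 hv)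
    exact ⟨w, (hC w).2 hw, h⟩
  have hcolinj : ∀ v ∈ C, ∀ w ∈ C, col v = col w → v = w :=
    fun v hv w hw h => hqinj v hv w hw (congrArg row h)
  -- `P` and `Q` are the indicators of the cells where the cycles meet positive and negative entries
  -- of `u`.
  let P : Fin l × Fin m → ℤ := fun p => ∑ v ∈ C, if p = (v.1, col v) then 1 else 0
  let Q : Fin l × Fin m → ℤ := fun p => ∑ v ∈ C, if p = ((q v).1, col v) then 1 else 0
  have hP0 : ∀ p, 0 ≤ P p := fun p => Finset.sum_nonneg fun _ _ => by split_ifs <;> simp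
  have hQ0 : ∀ p, 0 ≤ Q p := fun p => Finset.sum_nonneg fun _ _ => by split_ifs <;> simp
  have hP1 : ∀ p, P p ≤ 1 := by
    intro p
    simp only [P, Finset.sum_boole]
    norm_cast
    refine Finset.card_le_one.2 fun v hv w hw => ?_
    rw [Finset.mem_filter] at hv hw
    exact Subtype.ext (Prod.ext_iff.1 (hv.2.symm.trans hw.2)).1
  have hQ1 : ∀ p, Q p ≤ 1 := by
    intro p
    simp only [Q, Finset.sum_boole]
    norm_cast
    refine Finset.card_le_one.2 fun v hv w hw => ?_
    rw [Finset.mem_filter] at hv hw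
    exact hcolinj v hv.1 w hw.1 (Prod.ext_iff.1 (hv.2.symm.trans hw.2)).2
  have hPu : ∀ p, u p ≤ 0 → P p = 0 := by
    intro p hp
    refine Finset.sum_eq_zero fun v _ => if_neg ?_
    rintro rfl
    exact absurd (hcol v) (not_lt.2 hp)
  have hQu : ∀ p, 0 ≤ u p → Q p = 0 := by
    intro p hp
    refine Finset.sum_eq_zero fun v _ => if_neg ?_
    rintro rfl
    exact absurd (hq v) (not_lt.2 hp)
  have hw : ∀ w : Fin l × Fin m → ℤ, ∑ p, w p * (P p - Q p) =
      ∑ v ∈ C, (w (v.1, col v) - w ((q v).1, col v)) := by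
    intro w
    simp only [mul_sub, P, Q, Finset.mul_sum, Finset.sum_sub_distrib]
    congr 1 <;>
    · rw [Finset.sum_comm]
      simp
  refine ⟨fun p => P p - Q p, ⟨?_, fun w hw01 => ?_⟩, ?_, ?_⟩
  · rw [bipartiteIncidence_mulVec_eq_zero_iff]
    constructor
    · intro i
      have := hw fun p => if p.1 = i then 1 else 0
      simp only [Fintype.sum_prod_type, ite_mul, one_mul, zero_mul] at this
      rw [Finset.sum_eq_single i (fun i' _ h => by simp [h]) (by simp)] at this
      simp only [if_true] at this
      rw [this, Finset.sum_sub_distrib, sub_eq_zero]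
      symm
      exact Finset.sum_bij (fun v _ => q v) hqC (fun v hv w hw h => hqinj v hv w hw h) hqsurj
        fun _ _ => rfl
    · intro j
      have := hw fun p => if p.2 = j then 1 else 0
      simpa [Fintype.sum_prod_type] using this
  · rw [hw w]
    -- Each row of `C` contributes a difference of two values in `{0, 1}`, and `C` injects into the
    -- rows and, via `col`, into the columns.
    have h1 : |∑ v ∈ C, (w (v.1, col v) - w ((q v).1, col v))| ≤ C.card := by
      refine (Finset.abs_sum_le_sum_abs _ _).trans ?_
      rw [Finset.card_eq_sum_ones, Nat.cast_sum]
      refine Finset.sum_le_sum fun v _ => ?_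
      rcases hw01 (v.1, col v) with h | h <;> rcases hw01 ((q v).1, col v) with h' | h' <;>
        simp [h, h']
    refine h1.trans ?_
    norm_cast
    refine le_min ?_ ?_
    · have := C.card_le_univ.trans (Fintype.card_subtype_le _)
      simpa using this
    · rw [← Finset.card_image_of_injOn (f := col) fun v hv w hw h => hcolinj v hv w hw h]
      simpa using (C.image col).card_le_univ
  · obtain ⟨v, hv⟩ := periodicPts_nonempty q
    intro h0
    have h1 := congrFun h0 (v.1, col v)
    have h2 : (1 : ℤ) ≤ P (v.1, col v) := by
      have : (if (v.1, col v) = (v.1, col v) then (1 : ℤ) else 0) ≤ P (v.1, col v) :=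
        Finset.single_le_sum (f := fun w : V => if (v.1, col v) = (w.1, col w) then (1 : ℤ)
          else 0) (fun _ _ => by split_ifs <;> simp) ((hC v).2 hv)
      rwa [if_pos rfl] at this
    have h3 := hQu _ (hcol v).le
    simp only [Pi.zero_apply] at h1
    omega
  · rw [conformal_iff]
    intro p
    have h1 := hP0 p
    have h2 := hQ0 p
    have h3 := hP1 p
    have h4 := hQ1 p
    have h5 := hPu p
    have h6 := hQu p
    rcases lt_trichotomy (u p) 0 with h | h | h
    · rw [h5 h.le, abs_of_neg h, abs_of_nonpos (by omega), abs_of_nonpos (by omega)]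
      ring
    · simp [h5 h.le, h6 h.ge]
    · rw [h6 h.le, abs_of_pos h, abs_of_nonneg (by omega), abs_of_nonneg (by omega)]
      ring

theorem dominating_shortKernel (l m : ℕ) :
    Dominating (bipartiteIncidence l m) (shortKernel l m) := by
  refine ⟨fun y hy => hy.1, fun u hu hu0 => ?_⟩
  rw [bipartiteIncidence_mulVec_eq_zero_iff] at hu
  exact exists_shortKernel_conformal hu.1 hu.2 hu0

theorem bddAbove_tableBrickCounts (l m : ℕ) : BddAbove (tableBrickCounts l m) :=
  bddAbove_brickCounts 1 (finite_shortKernel l m) (dominating_shortKernel l m)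

theorem exists_mem_tableBrickCounts_pos {l m : ℕ} (hl : 2 ≤ l) (hm : 2 ≤ m) :
    ∃ c ∈ tableBrickCounts l m, 0 < c := by
  let i₀ : Fin l := ⟨0, by omega⟩
  let i₁ : Fin l := ⟨1, by omega⟩
  let j₀ : Fin m := ⟨0, by omega⟩
  let j₁ : Fin m := ⟨1, by omega⟩
  let α : Fin l → ℤ := Pi.single i₀ 1 - Pi.single i₁ 1
  let β : Fin m → ℤ := Pi.single j₀ 1 - Pi.single j₁ 1
  have hα : ∑ i, α i = 0 := by simp [α]
  have hβ : ∑ j, β j = 0 := by simp [β]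
  -- The basic `2 × 2` move in one layer and its negative in the other.
  let x : Fin 2 × (Fin l × Fin m) → ℤ := fun p =>
    (![1, -1] : Fin 2 → ℤ) p.1 * (α p.2.1 * β p.2.2)
  have hx : nFold 2 (1 : Matrix (Fin l × Fin m) (Fin l × Fin m) ℤ) (bipartiteIncidence l m) *ᵥ x = 0 := by
    rw [nFold_mulVec_eq_zero_iff]
    refine ⟨?_, fun k => ?_⟩
    · rw [Matrix.one_mulVec]
      funext t
      simp [x, Fin.sum_univ_two]
    · rw [bipartiteIncidence_mulVec_eq_zero_iff]
      constructor
      · intro i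
        simp [x, ← Finset.mul_sum, hβ]
      · intro j
        simp [x, ← Finset.mul_sum, ← Finset.sum_mul, hα]
  have hx0 : x ≠ 0 := by
    refine Function.ne_iff.2 ⟨(0, (i₀, j₀)), ?_⟩
    simp [x, α, β, i₀, i₁, j₀, j₁, Pi.single_apply]
  obtain ⟨h, hh, -⟩ := exists_mem_graverBasis_conformal _ x hx hx0
  refine ⟨_, ⟨2, h, hh, rfl⟩, ?_⟩
  obtain ⟨⟨k, t⟩, hkt⟩ := Function.ne_iff.1 hh.2.1
  exact (Set.ncard_pos (Set.toFinite _)).2 ⟨k, t, hkt⟩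

theorem isGreatest_g {l m : ℕ} (hl : 2 ≤ l) (hm : 2 ≤ m) :
    IsGreatest (tableBrickCounts l m) (g l m) := by
  obtain ⟨c, hc, -⟩ := exists_mem_tableBrickCounts_pos hl hm
  exact ⟨Nat.sSup_mem ⟨c, hc⟩ (bddAbove_tableBrickCounts l m),
    fun b hb => le_csSup (bddAbove_tableBrickCounts l m) hb⟩

theorem one_le_g {l m : ℕ} (hl : 2 ≤ l) (hm : 2 ≤ m) : 1 ≤ g l m := by
  obtain ⟨c, hc, hpos⟩ := exists_mem_tableBrickCounts_pos hl hm
  exact hpos.trans_le ((isGreatest_g hl hm).2 hc)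

/-! ### Regions of central hyperplane arrangements -/

/-- A family of `d` sign conditions in `ℝ^d` is not shattered by a half space. -/
theorem card_lt_of_shattered {d : ℕ} {ι : Type*} (e : ι → Fin d → ℝ) (e₀ : Fin d → ℝ)
    (T : Finset ι) (hT : ∀ s ⊆ T, ∃ c : Fin d → ℝ, 0 < c ⬝ᵥ e₀ ∧
      (∀ i ∈ s, 0 < c ⬝ᵥ e i) ∧ ∀ i ∈ T, i ∉ s → c ⬝ᵥ e i < 0) : T.card < d := by
  classical
  by_contra hd
  push Not at hd
  let v : Option T → Fin d → ℝ := fun o => o.elim e₀ fun i => e i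
  -- With `e₀` added there are at least `d + 1` vectors in dimension `d`.
  have hdep : ¬ LinearIndependent ℝ v := by
    intro h
    have := h.fintype_card_le_finrank
    simp at this
    omega
  have key : ∃ a : Option T → ℝ, ∑ o, a o • v o = 0 ∧ 0 ≤ a none ∧ ∃ o, a o ≠ 0 := by
    obtain ⟨a, ha, o, ho⟩ := Fintype.not_linearIndependent_iff.1 hdep
    rcases le_total 0 (a none) with h | h
    · exact ⟨a, ha, h, o, ho⟩
    · refine ⟨-a, ?_, by simpa using h, o, by simpa using ho⟩
      simp [Finset.sum_neg_distrib, ha]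
  obtain ⟨a, ha, ha0, o, ho⟩ := key
  -- Prescribing the signs of the dependency's coefficients makes every term of the relation, paired
  -- with `c`, nonnegative and some term positive, although the sum is zero.
  obtain ⟨c, hc0, hpos, hneg⟩ := hT
    ((Finset.univ.filter fun i : T => 0 < a (some i)).map (Function.Embedding.subtype _))
    (by intro i hi; simp only [Finset.mem_map] at hi; obtain ⟨j, -, rfl⟩ := hi; exact j.2)
  have hterm : ∀ i : T, 0 ≤ a (some i) * (c ⬝ᵥ e i) ∧
      (a (some i) ≠ 0 → 0 < a (some i) * (c ⬝ᵥ e i)) := by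
    intro i
    by_cases h : 0 < a (some i)
    · have := hpos i (Finset.mem_map.2 ⟨i, by simpa using h, rfl⟩)
      exact ⟨by positivity, fun _ => by positivity⟩
    · have := hneg i i.2 (by
        intro hi
        obtain ⟨j, hj, hji⟩ := Finset.mem_map.1 hi
        have : j = i := Subtype.ext hji
        subst this
        exact h (Finset.mem_filter.1 hj).2)
      push Not at h
      exact ⟨mul_nonneg_of_nonpos_of_nonpos h this.le,
        fun h' => mul_pos_of_neg_of_neg (lt_of_le_of_ne h h') this⟩
  have hsum : a none * (c ⬝ᵥ e₀) + ∑ i : T, a (some i) * (c ⬝ᵥ e i) = 0 := by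
    have := congrArg (fun x => c ⬝ᵥ x) ha
    simpa [dotProduct_sum, dotProduct_smul, Fintype.sum_option, v, smul_eq_mul,
      dotProduct_add] using this
  have h1 : 0 ≤ a none * (c ⬝ᵥ e₀) := by positivity
  have h2 : 0 ≤ ∑ i : T, a (some i) * (c ⬝ᵥ e i) := Finset.sum_nonneg fun i _ => (hterm i).1
  rcases o with _ | i
  · have : 0 < a none * (c ⬝ᵥ e₀) := mul_pos (lt_of_le_of_ne ha0 (Ne.symm ho)) hc0
    linarith
  · have : 0 < ∑ i : T, a (some i) * (c ⬝ᵥ e i) :=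
      Finset.sum_pos' (fun i _ => (hterm i).1) ⟨i, Finset.mem_univ _, (hterm i).2 ho⟩
    linarith

/-- The sign patterns of vectors in general position on one side of a hyperplane. -/
theorem card_le_of_half_patterns {d : ℕ} (hd : 1 ≤ d) {ι : Type*} [Fintype ι] [DecidableEq ι]
    (e : ι → Fin d → ℝ) (e₀ : Fin d → ℝ) (𝒜 : Finset (Finset ι))
    (h𝒜 : ∀ s ∈ 𝒜, ∃ c : Fin d → ℝ, 0 < c ⬝ᵥ e₀ ∧
      (∀ i ∈ s, 0 < c ⬝ᵥ e i) ∧ ∀ i ∉ s, c ⬝ᵥ e i < 0) :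
    𝒜.card ≤ ∑ k ∈ Finset.range d, (Fintype.card ι).choose k := by
  -- Sauer–Shelah, with VC dimension at most `d - 1`.
  refine 𝒜.card_le_card_shatterer.trans (Finset.card_shatterer_le_sum_vcDim.trans ?_)
  refine Finset.sum_le_sum_of_subset fun k hk => ?_
  rw [Finset.mem_Iic] at hk
  rw [Finset.mem_range]
  have : 𝒜.vcDim ≤ d - 1 := by
    refine Finset.sup_le fun T hT => ?_
    rw [Finset.mem_shatterer] at hT
    have := card_lt_of_shattered e e₀ T fun s hs => by
      obtain ⟨u, hu, hus⟩ := hT hs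
      obtain ⟨c, h0, h1, h2⟩ := h𝒜 u hu
      refine ⟨c, h0, fun i hi => h1 i ?_, fun i hi his => h2 i fun hiu => his ?_⟩
      · rw [← hus] at hi
        exact (Finset.mem_inter.1 hi).2
      · rw [← hus]
        exact Finset.mem_inter.2 ⟨hi, hiu⟩
    omega
  omega

/-- The number of regions of a central hyperplane arrangement, counted by sign patterns. -/
theorem card_le_of_patterns {d : ℕ} (hd : 1 ≤ d) {ι : Type*} [Fintype ι] [Nonempty ι]
    (e : ι → Fin d → ℝ) (𝒜 : Finset (Finset ι))
    (h𝒜 : ∀ s ∈ 𝒜, ∃ c : Fin d → ℝ, (∀ i ∈ s, 0 < c ⬝ᵥ e i) ∧ ∀ i ∉ s, c ⬝ᵥ e i < 0) :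
    𝒜.card ≤ 2 * ∑ k ∈ Finset.range d, (Fintype.card ι - 1).choose k := by
  classical
  obtain ⟨i₀⟩ := ‹Nonempty ι›
  have hcard : Fintype.card {i // i ≠ i₀} = Fintype.card ι - 1 := by
    simp [Fintype.card_subtype_compl]
  have hinj : ∀ s t : Finset ι, (i₀ ∈ s ↔ i₀ ∈ t) →
      s.subtype (· ≠ i₀) = t.subtype (· ≠ i₀) → s = t := by
    intro s t h0 h
    ext i
    by_cases hi : i = i₀
    · rw [hi]; exact h0
    · have := congrArg (fun r => (⟨i, hi⟩ : {i // i ≠ i₀}) ∈ r) h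
      simpa using this
  -- Split by the side of the hyperplane of `i₀`; on the negative side `-e i₀` plays the role of
  -- `e₀`.
  rw [← Finset.card_filter_add_card_filter_not (fun s => i₀ ∈ s), two_mul, ← hcard]
  refine Nat.add_le_add ?_ ?_
  · rw [← Finset.card_image_of_injOn (f := fun s : Finset ι => s.subtype (· ≠ i₀))]
    · refine card_le_of_half_patterns hd (fun i : {i // i ≠ i₀} => e i) (e i₀) _ fun s hs => ?_
      simp only [Finset.mem_image, Finset.mem_filter] at hs
      obtain ⟨t, ⟨ht, h0⟩, rfl⟩ := hs
      obtain ⟨c, h1, h2⟩ := h𝒜 t ht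
      exact ⟨c, h1 _ h0, fun i hi => h1 _ (by simpa using hi), fun i hi => h2 _ (by simpa using hi)⟩
    · intro s hs t ht h
      simp only [Finset.coe_filter, Set.mem_ofPred_eq] at hs ht
      exact hinj s t (by simp [hs.2, ht.2]) h
  · rw [← Finset.card_image_of_injOn (f := fun s : Finset ι => s.subtype (· ≠ i₀))]
    · refine card_le_of_half_patterns hd (fun i : {i // i ≠ i₀} => e i) (-e i₀) _ fun s hs => ?_
      simp only [Finset.mem_image, Finset.mem_filter] at hs
      obtain ⟨t, ⟨ht, h0⟩, rfl⟩ := hs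
      obtain ⟨c, h1, h2⟩ := h𝒜 t ht
      exact ⟨c, by simpa using h2 _ h0, fun i hi => h1 _ (by simpa using hi),
        fun i hi => h2 _ (by simpa using hi)⟩
    · intro s hs t ht h
      simp only [Finset.coe_filter, Set.mem_ofPred_eq] at hs ht
      exact hinj s t (by simp [hs.2, ht.2]) h

/-! ### Generic functionals exposing vertices -/

/-- A vertex of the convex hull of a finite set is the unique maximizer of a functional. -/
theorem exists_dotProduct_lt_of_mem_extremePoints {d : ℕ} {P : Set (Fin d → ℝ)} (hP : P.Finite)
    {v : Fin d → ℝ} (hv : v ∈ (convexHull ℝ P).extremePoints ℝ) :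
    ∃ c : Fin d → ℝ, ∀ p ∈ P, p ≠ v → c ⬝ᵥ p < c ⬝ᵥ v := by
  have h1 := ((convex_convexHull ℝ P).mem_extremePoints_iff_mem_sdiff_convexHull_sdiff.1 hv).2
  have h2 : v ∉ convexHull ℝ (P \ {v}) := fun h =>
    h1 (convexHull_mono (Set.sdiff_subset_sdiff_left (subset_convexHull ℝ P)) h)
  have h3 : IsClosed (convexHull ℝ (P \ {v})) :=
    (hP.subset Set.sdiff_subset).isClosed_convexHull ℝ
  obtain ⟨f, a, hf, hfv⟩ := geometric_hahn_banach_closed_point (convex_convexHull ℝ _) h3 h2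
  have hdot : ∀ x, (fun i => f (Pi.single i 1)) ⬝ᵥ x = f x := by
    intro x
    have := LinearMap.pi_apply_eq_sum_univ f.toLinearMap x
    simp only [ContinuousLinearMap.coe_coe, smul_eq_mul] at this
    rw [this, dotProduct]
    refine Finset.sum_congr rfl fun i _ => ?_
    rw [mul_comm]
    congr 2
    funext j
    simp [Pi.single_apply, eq_comm]
  refine ⟨fun i => f (Pi.single i 1), fun p hp hpv => ?_⟩
  rw [hdot, hdot]
  exact (hf p (subset_convexHull ℝ _ ⟨hp, hpv⟩)).trans hfv

theorem exists_dotProduct_ne_zero {d : ℕ} {E : Set (Fin d → ℝ)} (hE : E.Finite)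
    (h0 : ∀ e ∈ E, e ≠ 0) : ∃ u : Fin d → ℝ, ∀ e ∈ E, u ⬝ᵥ e ≠ 0 := by
  have := hE.to_subtype
  obtain ⟨f, hf⟩ := Module.exists_dual_forall_apply_ne_zero (K := ℝ)
    (fun e : E => (e : Fin d → ℝ)) fun e => h0 e e.2
  refine ⟨fun i => f (Pi.single i 1), fun e he => ?_⟩
  have hdot : (fun i => f (Pi.single i 1)) ⬝ᵥ e = f e := by
    rw [LinearMap.pi_apply_eq_sum_univ f e, dotProduct]
    refine Finset.sum_congr rfl fun i _ => ?_
    rw [smul_eq_mul, mul_comm]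
    congr 2
    funext j
    simp [Pi.single_apply, eq_comm]
  rw [hdot]
  exact hf ⟨e, he⟩

/-- The functional exposing a vertex can be chosen in general position. -/
theorem exists_generic_dotProduct_lt {d : ℕ} {P : Set (Fin d → ℝ)} (hP : P.Finite)
    {v : Fin d → ℝ} (hv : v ∈ (convexHull ℝ P).extremePoints ℝ) {E : Set (Fin d → ℝ)}
    (hE : E.Finite) (h0 : ∀ e ∈ E, e ≠ 0) :
    ∃ c : Fin d → ℝ, (∀ p ∈ P, p ≠ v → c ⬝ᵥ p < c ⬝ᵥ v) ∧ ∀ e ∈ E, c ⬝ᵥ e ≠ 0 := by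
  obtain ⟨c, hc⟩ := exists_dotProduct_lt_of_mem_extremePoints hP hv
  obtain ⟨u, hu⟩ := exists_dotProduct_ne_zero hE h0
  -- Perturb `c` to `c + ε • u` with small `ε > 0`: strict inequalities survive, and wherever `c`
  -- vanishes on `E` the term `ε • u` does not.
  have hcont : ∀ x : Fin d → ℝ,
      Filter.Tendsto (fun ε : ℝ => (c + ε • u) ⬝ᵥ x) (nhdsWithin 0 (Set.Ioi 0))
        (nhds (c ⬝ᵥ x)) := by
    intro x
    have h : Continuous fun ε : ℝ => (c + ε • u) ⬝ᵥ x := by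
      simp only [add_dotProduct, smul_dotProduct, smul_eq_mul]
      fun_prop
    have := (h.tendsto 0).mono_left (nhdsWithin_le_nhds (s := Set.Ioi 0))
    simpa using this
  have hA : ∀ᶠ ε : ℝ in nhdsWithin 0 (Set.Ioi 0), ∀ p ∈ P, p ≠ v →
      (c + ε • u) ⬝ᵥ p < (c + ε • u) ⬝ᵥ v := by
    rw [Filter.eventually_all_finite hP]
    intro p hp
    by_cases hpv : p = v
    · simp [hpv]
    · filter_upwards [(hcont p).eventually_lt (hcont v) (hc p hp hpv)] with ε hε _ using hε
  have hB : ∀ᶠ ε : ℝ in nhdsWithin 0 (Set.Ioi 0), ∀ e ∈ E, (c + ε • u) ⬝ᵥ e ≠ 0 := by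
    rw [Filter.eventually_all_finite hE]
    intro e he
    by_cases hce : c ⬝ᵥ e = 0
    · filter_upwards [self_mem_nhdsWithin] with ε hε
      rw [add_dotProduct, smul_dotProduct, hce, zero_add]
      exact mul_ne_zero (ne_of_gt hε) (hu e he)
    · exact (hcont e).eventually_ne hce
  obtain ⟨ε, h1, h2⟩ := (hA.and hB).exists
  exact ⟨_, h1, h2⟩

/-! ### Box vectors and the vertex count -/

/-- The real vector of an integer vector. -/
def realVec {d : ℕ} (e : Fin d → ℤ) : Fin d → ℝ := fun i => (e i : ℝ)

@[simp] theorem realVec_zero {d : ℕ} : realVec (0 : Fin d → ℤ) = 0 := by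
  funext i; simp [realVec]

theorem realVec_neg {d : ℕ} (e : Fin d → ℤ) : realVec (-e) = -realVec e := by
  funext i; simp [realVec]

theorem realVec_add {d : ℕ} (e e' : Fin d → ℤ) : realVec (e + e') = realVec e + realVec e' := by
  funext i; simp [realVec]

theorem realVec_sum {d : ℕ} {J : Type*} [Fintype J] (e : J → Fin d → ℤ) :
    realVec (∑ j, e j) = ∑ j, realVec (e j) := by
  funext i; simp [realVec]

theorem realVec_ne_zero {d : ℕ} {e : Fin d → ℤ} (he : e ≠ 0) : realVec e ≠ 0 := by
  obtain ⟨i, hi⟩ := Function.ne_iff.1 he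
  exact Function.ne_iff.2 ⟨i, by simpa [realVec] using hi⟩

/-- The integer vectors with entries of absolute value at most `K`. -/
noncomputable def box (d K : ℕ) : Finset (Fin d → ℤ) :=
  Fintype.piFinset fun _ => Finset.Icc (-(K : ℤ)) K

theorem mem_box {d K : ℕ} {e : Fin d → ℤ} : e ∈ box d K ↔ ∀ i, |e i| ≤ K := by
  simp [box, abs_le]

open Classical in
/-- The lexicographically positive vectors of the box. -/
noncomputable def halfBox (d K : ℕ) : Finset (Fin d → ℤ) :=
  (box d K).filter fun e => 0 < toLex e

theorem mem_halfBox {d K : ℕ} {e : Fin d → ℤ} : e ∈ halfBox d K ↔ e ∈ box d K ∧ 0 < toLex e := by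
  classical
  rw [halfBox, Finset.mem_filter]

theorem neg_mem_halfBox {d K : ℕ} {e : Fin d → ℤ} (he : e ∈ box d K) (h : toLex e < 0) :
    -e ∈ halfBox d K := by
  rw [mem_halfBox, mem_box, toLex_neg]
  exact ⟨fun i => by simpa using mem_box.1 he i, by simpa using h⟩

/-- Negation exchanges the lexicographically positive and negative box vectors, leaving only zero.
-/
theorem two_mul_card_halfBox (d K : ℕ) : 2 * (halfBox d K).card + 1 = (2 * K + 1) ^ d := by
  classical
  have hbox : (box d K).card = (2 * K + 1) ^ d := by
    simp only [box, Fintype.card_piFinset, Int.card_Icc, Finset.prod_const, Finset.card_univ,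
      Fintype.card_fin]
    congr 1
    omega
  have hneg : ((box d K).filter fun e => toLex e < 0).card = (halfBox d K).card := by
    refine Finset.card_bij (fun e _ => -e) (fun e he => ?_) (fun _ _ _ _ h => neg_injective h)
      fun e he => ?_
    · rw [Finset.mem_filter] at he
      exact neg_mem_halfBox he.1 he.2
    · rw [mem_halfBox, mem_box] at he
      refine ⟨-e, ?_, neg_neg e⟩
      rw [Finset.mem_filter, mem_box, toLex_neg]
      exact ⟨fun i => by simpa using he.1 i, by simpa using he.2⟩
  have hzero : ((box d K).filter fun e => toLex e = 0).card = 1 := by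
    rw [Finset.card_eq_one]
    refine ⟨0, ?_⟩
    ext e
    rw [Finset.mem_filter, mem_box, Finset.mem_singleton, toLex_eq_zero]
    constructor
    · exact fun h => h.2
    · rintro rfl
      simp
  have h1 := Finset.card_filter_add_card_filter_not (s := box d K) (fun e => 0 < toLex e)
  have h2 := Finset.card_filter_add_card_filter_not
    (s := (box d K).filter fun e => ¬ 0 < toLex e) (fun e => toLex e < 0)
  rw [Finset.filter_filter, Finset.filter_filter] at h2
  have h3 : ((box d K).filter fun e => ¬ 0 < toLex e ∧ toLex e < 0) =
      (box d K).filter fun e => toLex e < 0 :=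
    Finset.filter_congr fun e _ => ⟨fun h => h.2, fun h => ⟨h.not_gt, h⟩⟩
  have h4 : ((box d K).filter fun e => ¬ 0 < toLex e ∧ ¬ toLex e < 0) =
      (box d K).filter fun e => toLex e = 0 :=
    Finset.filter_congr fun e _ => ⟨fun h => le_antisymm (not_lt.1 h.1) (not_lt.1 h.2),
      fun h => by rw [h]; exact ⟨lt_irrefl _, lt_irrefl _⟩⟩
  rw [h3, h4, hneg, hzero] at h2
  change (halfBox d K).card + _ = _ at h1
  omega

/-- If any two points of `S` are joined by moves which keep `S` and whose projections lie in a box,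
then the number of vertices of the projection is bounded by the number of regions of the
arrangement of the hyperplanes orthogonal to the box vectors. -/
theorem encard_extremePoints_projection_le {d K : ℕ} (hd : 1 ≤ d) (hK : 1 ≤ K) {T : Type*}
    [Fintype T] (W : Matrix (Fin d) T ℤ) {S : Set (T → ℤ)} (hS : S.Finite)
    (hmove : ∀ x ∈ S, ∀ x' ∈ S, ∃ (N : ℕ) (v : Fin N → T → ℤ), ∑ j, v j = x' - x ∧
      ∀ j, x + v j ∈ S ∧ ∀ i, |(W *ᵥ v j) i| ≤ K) :
    ((projection W S).extremePoints ℝ).encard ≤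
      (2 * ∑ k ∈ Finset.range d, (((2 * K + 1) ^ d - 3) / 2).choose k : ℕ) := by
  classical
  let P : Set (Fin d → ℝ) := (fun x => realVec (W *ᵥ x)) '' S
  have hP : P.Finite := hS.image _
  change ((convexHull ℝ P).extremePoints ℝ).encard ≤ _
  set V := (convexHull ℝ P).extremePoints ℝ
  have hVP : V ⊆ P := extremePoints_convexHull_subset
  let ι := {e // e ∈ halfBox d K}
  let E : Set (Fin d → ℝ) := Set.range fun e : ι => realVec e.1
  have hE0 : ∀ e ∈ E, e ≠ 0 := by
    rintro _ ⟨e, rfl⟩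
    refine realVec_ne_zero fun h => ?_
    have := (mem_halfBox.1 e.2).2
    rw [h] at this
    exact lt_irrefl _ this
  have hgen : ∀ v : V, ∃ c : Fin d → ℝ, (∀ p ∈ P, p ≠ v → c ⬝ᵥ p < c ⬝ᵥ v) ∧
      ∀ e ∈ E, c ⬝ᵥ e ≠ 0 := fun v =>
    exists_generic_dotProduct_lt hP v.2 (Set.finite_range _) hE0
  choose c hc hcE using hgen
  let s : V → Finset ι := fun v => Finset.univ.filter fun e => 0 < c v ⬝ᵥ realVec e.1
  -- Signs on the half box determine signs on the whole box by negation; genericity excludes zeros.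
  have htransfer : ∀ v v' : V, s v = s v' → ∀ e ∈ box d K,
      c v ⬝ᵥ realVec e ≤ 0 → c v' ⬝ᵥ realVec e ≤ 0 := by
    intro v v' hs e he hle
    have hiff : ∀ f (hf : f ∈ halfBox d K), 0 < c v ⬝ᵥ realVec f ↔ 0 < c v' ⬝ᵥ realVec f := by
      intro f hf
      have := congrArg (fun r => (⟨f, hf⟩ : ι) ∈ r) hs
      simpa [s] using this
    rcases lt_trichotomy (toLex e) 0 with h | h | h
    · have hmem := neg_mem_halfBox he h
      have h1 : c v ⬝ᵥ realVec (-e) ≠ 0 := hcE v _ ⟨⟨-e, hmem⟩, rfl⟩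
      have h2 := hiff _ hmem
      rw [realVec_neg, dotProduct_neg] at h1 h2
      rw [dotProduct_neg] at h2
      have h3 := h2.1 (lt_of_le_of_ne (by linarith) (Ne.symm h1))
      linarith
    · rw [toLex_eq_zero] at h
      simp [h]
    · have hmem : e ∈ halfBox d K := mem_halfBox.2 ⟨he, h⟩
      by_contra hcon
      push Not at hcon
      exact absurd ((hiff e hmem).2 hcon) (not_lt.2 hle)
  have hsinj : Function.Injective s := by
    intro v v' hs
    by_contra hne
    obtain ⟨x, hx, hxv⟩ := hVP v.2
    obtain ⟨x', hx', hxv'⟩ := hVP v'.2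
    dsimp only at hxv hxv'
    obtain ⟨N, w, hw, hmoves⟩ := hmove x hx x' hx'
    -- No move from `v` improves `c v`, hence none improves `c v'`. Summing the moves, `v'` is no
    -- better than `v` for `c v'`, against its being the unique maximizer.
    have h1 : ∀ j, c v ⬝ᵥ realVec (W *ᵥ w j) ≤ 0 := by
      intro j
      have hle : c v ⬝ᵥ realVec (W *ᵥ (x + w j)) ≤ c v ⬝ᵥ v := by
        by_cases h : realVec (W *ᵥ (x + w j)) = v
        · rw [h]
        · exact (hc v _ ⟨_, (hmoves j).1, rfl⟩ h).le
      rw [Matrix.mulVec_add, realVec_add, dotProduct_add, hxv] at hle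
      linarith
    have h2 : ∀ j, c v' ⬝ᵥ realVec (W *ᵥ w j) ≤ 0 := fun j =>
      htransfer v v' hs _ (mem_box.2 (hmoves j).2) (h1 j)
    have h3 : (v' : Fin d → ℝ) = v + ∑ j, realVec (W *ᵥ w j) := by
      rw [← hxv, ← hxv', ← realVec_sum, ← realVec_add, ← Matrix.mulVec_sum, hw,
        ← Matrix.mulVec_add, add_sub_cancel]
    have h4 : c v' ⬝ᵥ (v' : Fin d → ℝ) ≤ c v' ⬝ᵥ v := by
      conv_lhs => rw [h3]
      rw [dotProduct_add, dotProduct_sum]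
      have := Finset.sum_nonpos fun j (_ : j ∈ Finset.univ) => h2 j
      linarith
    have h5 := hc v' v (hVP v.2) fun h => hne (Subtype.ext h)
    linarith
  have hVfin : V.Finite := hP.subset hVP
  have := hVfin.fintype
  -- There are `((2K+1)^d - 1)/2` hyperplanes; the one singled out in the region count turns the `1`
  -- into a `3`.
  have hcard : Fintype.card ι = ((2 * K + 1) ^ d - 3) / 2 + 1 := by
    have h1 := two_mul_card_halfBox d K
    have h2 : 2 * K + 1 ≤ (2 * K + 1) ^ d := Nat.le_self_pow (by omega) _
    rw [Fintype.card_coe]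
    omega
  have : Nonempty ι := Fintype.card_pos_iff.1 (by omega)
  have hmain := card_le_of_patterns hd (fun e : ι => realVec e.1) (Finset.univ.image s) (by
    intro r hr
    obtain ⟨v, -, rfl⟩ := Finset.mem_image.1 hr
    refine ⟨c v, fun e he => (Finset.mem_filter.1 he).2, fun e he => ?_⟩
    have h1 : ¬ 0 < c v ⬝ᵥ realVec e.1 := fun h => he (Finset.mem_filter.2 ⟨Finset.mem_univ _, h⟩)
    exact lt_of_le_of_ne (not_lt.1 h1) (hcE v _ ⟨e, rfl⟩))
  rw [Finset.card_image_of_injective _ hsinj, hcard, Nat.add_sub_cancel] at hmain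
  rw [Set.encard_eq_coe_toFinset_card, Set.toFinset_card]
  exact_mod_cast hmain

/-! ### Graver moves between tables and the final bounds -/

theorem finite_tables {l m n : ℕ} (a : Fin m → Fin n → ℤ) (b : Fin l → Fin n → ℤ)
    (c : Fin l → Fin m → ℤ) : (tables a b c).Finite := by
  refine Set.Finite.subset (Set.Finite.pi' (t := fun p : Fin l × Fin m × Fin n =>
    Set.Icc 0 (a p.2.1 p.2.2)) fun _ => Set.finite_Icc _ _) ?_
  rintro x ⟨h0, h1, -, -⟩ ⟨i, j, k⟩
  refine ⟨h0 _, ?_⟩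
  dsimp only
  rw [← h1]
  exact Finset.single_le_sum (f := fun i => x (i, j, k)) (fun _ _ => h0 _) (Finset.mem_univ i)

/-- Any two tables with the same line sums are joined by Graver moves. -/
theorem exists_moves_tables {d l m n : ℕ} {a : Fin m → Fin n → ℤ} {b : Fin l → Fin n → ℤ}
    {c : Fin l → Fin m → ℤ} {W : Matrix (Fin d) (Fin l × Fin m × Fin n) ℤ}
    (hW : ∀ i p, W i p = 0 ∨ W i p = 1) {x x' : Fin l × Fin m × Fin n → ℤ}
    (hx : x ∈ tables a b c) (hx' : x' ∈ tables a b c) :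
    ∃ (N : ℕ) (v : Fin N → Fin l × Fin m × Fin n → ℤ), ∑ j, v j = x' - x ∧
      ∀ j, x + v j ∈ tables a b c ∧ ∀ i, |(W *ᵥ v j) i| ≤ (g l m * min l m : ℕ) := by
  let A := nFold n (1 : Matrix (Fin l × Fin m) (Fin l × Fin m) ℤ) (bipartiteIncidence l m)
  let K : AddSubgroup (Fin n × (Fin l × Fin m) → ℤ) := A.mulVecLin.toAddMonoidHom.ker
  have hK : ∀ u, u ∈ K ↔ A *ᵥ u = 0 := fun u => Iff.rfl
  have hker : ∀ u : Fin n × (Fin l × Fin m) → ℤ, A *ᵥ u = 0 ↔ (∀ i j, ∑ k, u (k, i, j) = 0) ∧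
      ∀ k, (∀ i, ∑ j, u (k, i, j) = 0) ∧ ∀ j, ∑ i, u (k, i, j) = 0 := by
    intro u
    simp only [A, nFold_mulVec_eq_zero_iff, bipartiteIncidence_mulVec_eq_zero_iff,
      Matrix.one_mulVec]
    simp only [funext_iff, Prod.forall, Pi.zero_apply]
  -- The layer index moves to the front, so that layer `k` is the `k`-th brick.
  let z : Fin n × (Fin l × Fin m) → ℤ := fun q => x' (q.2.1, q.2.2, q.1) - x (q.2.1, q.2.2, q.1)
  have hz : A *ᵥ z = 0 := by
    rw [hker]
    simp [z, Finset.sum_sub_distrib, hx.2.1, hx.2.2.1, hx.2.2.2, hx'.2.1, hx'.2.2.1, hx'.2.2.2]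
  obtain ⟨N, v, hv, hsum, habs⟩ := exists_conformal_sum K (graverBasis A)
    (fun u hu => (hK u).2 hu.1) (fun u hu hu0 => by
      obtain ⟨h, hh, hc⟩ := exists_mem_graverBasis_conformal A u ((hK u).1 hu) hu0
      exact ⟨h, hh, hh.2.1, hc⟩) z ((hK z).2 hz)
  refine ⟨N, fun j p => v j (p.2.2, p.1, p.2.1), ?_, fun j => ⟨?_, fun i => ?_⟩⟩
  · funext p
    have := congrFun hsum (p.2.2, p.1, p.2.1)
    simpa [z] using this
  · obtain ⟨h1, h2⟩ := (hker _).1 (hv j).1.1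
    refine ⟨fun p => ?_, fun j k => ?_, fun i k => ?_, fun i j => ?_⟩
    -- By conformality each entry of `x + v j` lies between those of `x` and `x'`, so it is
    -- nonnegative.
    · obtain ⟨hc1, hc2⟩ := conformal_of_sum_abs hsum habs j (p.2.2, p.1, p.2.1)
      have h3 := hx.1 p
      have h4 := hx'.1 p
      simp only [z, Prod.mk.eta] at hc1 hc2
      simp only [Pi.add_apply]
      by_contra hneg
      push Not at hneg
      have h5 : v j (p.2.2, p.1, p.2.1) < 0 := by omega
      have h6 : x' p - x p ≤ 0 := nonpos_of_mul_nonneg_right hc1 h5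
      rw [abs_of_neg h5, abs_of_nonpos h6] at hc2
      omega
    · simp [Finset.sum_add_distrib, hx.2.1, (h2 _).2]
    · simp [Finset.sum_add_distrib, hx.2.2.1, (h2 _).1]
    · simp [Finset.sum_add_distrib, hx.2.2.2, h1]
  · have := abs_dotProduct_le_of_mem_graverBasis (finite_shortKernel l m)
      (dominating_shortKernel l m) (hv j).1
      (fun q : Fin n × (Fin l × Fin m) => W i (q.2.1, q.2.2, q.1)) (K := min l m)
      fun k y hy => hy.2 _ fun p => hW i _
    refine le_trans (le_of_eq ?_) this
    congr 1
    refine Fintype.sum_equiv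
      ((Equiv.prodAssoc (Fin l) (Fin m) (Fin n)).symm.trans (Equiv.prodComm _ _)) _ _ fun p => ?_
    simp

theorem le_vertexBound {d l m : ℕ} (hd : 1 ≤ d) (hl : 2 ≤ l) (hm : 2 ≤ m) {v : ℕ∞}
    (hv : v ∈ vertexCounts d l m) : v ≤ (vertexBound d l m : ℕ∞) := by
  obtain ⟨n, a, b, c, W, hW, rfl⟩ := hv
  have hK : 1 ≤ g l m * min l m :=
    Nat.mul_pos (one_le_g hl hm) (lt_min (by omega) (by omega))
  have := encard_extremePoints_projection_le hd hK W (finite_tables a b c)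
    fun x hx x' hx' => exists_moves_tables hW hx hx'
  rwa [← mul_assoc] at this

theorem isGreatest_t {d l m : ℕ} (hd : 1 ≤ d) (hl : 2 ≤ l) (hm : 2 ≤ m) :
    IsGreatest (vertexCounts d l m) (t d l m) ∧ t d l m ≤ (vertexBound d l m : ℕ∞) := by
  have hle : t d l m ≤ (vertexBound d l m : ℕ∞) := sSup_le fun v hv => le_vertexBound hd hl hm hv
  have : Nonempty (vertexCounts d l m) :=
    -- The case `n = 0` shows that the set is nonempty; a finite supremum in `ℕ∞` is then attained.
    ⟨⟨_, 0, 0, 0, 0, 0, fun _ _ => Or.inl rfl, rfl⟩⟩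
  exact ⟨⟨ENat.sSup_mem_of_nonempty_of_lt_top (hle.trans_lt (ENat.natCast_lt_top _)),
    fun v hv => le_sSup hv⟩, hle⟩

/-- Each of the `d` binomials has lower index at most `d - 1`, so it is at most `(X + 1)^(d(d-1))`,
where `X = 2 * g l m * min l m`. Since `X ≥ 1`, replacing `X + 1` by `2 * X` costs a factor
depending only on `d`. -/
theorem vertexBound_le {d l m : ℕ} (hl : 2 ≤ l) (hm : 2 ≤ m) :
    vertexBound d l m ≤
      2 * (d * 2 ^ (d * (d - 1))) * (2 * g l m * min l m) ^ (d * (d - 1)) := by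
  have hX : 1 ≤ 2 * g l m * min l m :=
    Nat.mul_pos (Nat.mul_pos two_pos (one_le_g hl hm)) (lt_min (by omega) (by omega))
  set X := 2 * g l m * min l m with hXdef
  have hterm : ∀ k ∈ Finset.range d,
      (((X + 1) ^ d - 3) / 2).choose k ≤ (2 * X) ^ (d * (d - 1)) := by
    intro k hk
    rw [Finset.mem_range] at hk
    calc (((X + 1) ^ d - 3) / 2).choose k ≤ (((X + 1) ^ d - 3) / 2) ^ k := Nat.choose_le_pow _ _
      _ ≤ ((X + 1) ^ d) ^ k := Nat.pow_le_pow_left ((Nat.div_le_self _ _).trans (Nat.sub_le _ _)) k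
      _ ≤ ((X + 1) ^ d) ^ (d - 1) := Nat.pow_le_pow_right (by positivity) (by omega)
      _ = (X + 1) ^ (d * (d - 1)) := (pow_mul _ _ _).symm
      _ ≤ (2 * X) ^ (d * (d - 1)) := Nat.pow_le_pow_left (by omega) _
  have := Finset.sum_le_card_nsmul _ _ _ hterm
  rw [Finset.card_range, smul_eq_mul, mul_pow] at this
  calc vertexBound d l m ≤ 2 * (d * (2 ^ (d * (d - 1)) * X ^ (d * (d - 1)))) :=
        Nat.mul_le_mul_left 2 this
    _ = 2 * (d * 2 ^ (d * (d - 1))) * X ^ (d * (d - 1)) := by ring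

end CoarseProj

theorem proposition5p7 (d : ℕ) (hd : 1 ≤ d) :
    (∀ l m : ℕ, 2 ≤ l → 2 ≤ m →
      IsGreatest (CoarseProj.tableBrickCounts l m) (CoarseProj.g l m) ∧
      IsGreatest (CoarseProj.vertexCounts d l m) (CoarseProj.t d l m) ∧
      CoarseProj.t d l m ≤ (CoarseProj.vertexBound d l m : ℕ∞)) ∧
    ∃ C : ℝ, ∀ l m : ℕ, 2 ≤ l → 2 ≤ m →
      (CoarseProj.vertexBound d l m : ℝ) ≤
        C * (2 * (CoarseProj.g l m : ℝ) * (min l m : ℕ)) ^ (d * (d - 1)) := by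
  refine ⟨fun l m hl hm =>
    ⟨CoarseProj.isGreatest_g hl hm, CoarseProj.isGreatest_t hd hl hm⟩,
    ((2 * (d * 2 ^ (d * (d - 1))) : ℕ) : ℝ), fun l m hl hm => ?_⟩
  exact_mod_cast CoarseProj.vertexBound_le (d := d) hl hm
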